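/- **Conventions.** Let $\mathbf{Gr}$ be the category of undirected reflexive graphs: an object is a graph $(V,E)$ without parallel edges (every vertex implicitly carries a loop, and $E$ consists of the non-loop edges), and a homomorphism is a map of vertices sending each edge to an edge or collapsing it to a single vertex. Let $\mathbf{FinSet}^\star$ be the category of sequences $F=(F_n)_{n\in\mathbb N}$ of finite sets with $F_n=\emptyset$ for all but finitely many $n$ (morphisms are termwise maps), let $\mathbf{FinSet}^\star_k$ be its full subcategory of the sequences with $|F_n|\le k$ for all $n$ (this subcategory is pullback-absorbing), and let $\mathbf{Gr}^\star$ be the category of sequences of graphs of which all but finitely many are empty. The functor $\mathcal K^\star:\mathbf{FinSet}^\star\to\mathbf{Gr}^\star$ replaces each $F_n$ by the complete graph on $F_n$, and the functor $\mathfrak S:\mathbf{Gr}^\star\to\mathbf{Gr}$ sends $(F_n)_n$ to the disjoint union of the graphs $F_n$ together with all edges $xy$ with $x\in V(F_n)$, $y\in V(F_{n+1})$, $n\in\mathbb N$. For a graph $T$ given by sets of vertices and edges with source and target maps, $\int T$ is the category with one object for each vertex and each edge of $T$ and, for each edge, a span from it to its source and its target. A $\mathbf K$-valued structured decomposition of shape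 $T$ is a functor $d:\int T\to\mathbf K$. For a functor $\Omega:\mathbf K\to\mathbf C$ into a category with colimits, a class $\mathcal G$ of graphs, and a pullback-absorbing full subcategory $\mathbf B$ of $\mathbf K$, an object $x$ of $\mathbf C$ has *$(\mathcal G,\Omega)$-width bounded by $\mathbf B$* if there are $T\in\mathcal G$, a structured decomposition $d:\int T\to\mathbf B$ and a monomorphism $x\hookrightarrow\operatorname{colim}(\Omega\circ d)$ in $\mathbf C$. A *tree decomposition* of a graph $G$ is a tree $T$ with subgraphs $(B_t)_{t\in V(T)}$ of $G$ such that the ends of every edge of $G$ lie in a common $B_t$ and, for every vertex $x$ of $G$, the set $\{t: x\in B_t\}$ induces a non-empty connected subgraph of $T$. A *layering* of $G$ is a finite sequence $(L_1,\dots,L_m)$ of vertex subsets partitioning $V(G)$ such that every edge with ends in $L_i$ and $L_j$ satisfies $|i-j|\le 1$. The *layered tree-width* of $G$ is the minimum, over all tree decompositions and all layerings of $G$, of $\max_{t,i}|V(B_t)\cap L_i|$. **Proposition.** Let $k\in\mathbb N$ and let $G$ be a finite graph. Then $G$ has $(\text{forest},\mathfrak S\mathcal K^\star)$-width bounded by $\mathbf{FinSet}^\star_k$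 if and only if $G$ has layered tree-width at most $k$. -/

import Mathlib

open CategoryTheory CategoryTheory.Limits

universe u

namespace LayeredWidth

/-! ### The category of graphs -/

/-- Objects of the category of undirected reflexive graphs. A reflexive graph is recorded by its
non-loop edges, i.e. by a `SimpleGraph`; every vertex implicitly carries a loop. -/
structure Gr : Type (u + 1) where
  V : Type u
  graph : SimpleGraph V

namespace Gr

/-- A homomorphism of reflexive graphs: an edge is sent to an edge or collapsed to a (loop at a)
vertex. -/
@[ext]
structure Hom (G H : Gr.{u}) : Type u where
  toFun : G.V → H.V
  map_adj : ∀ {x y : G.V}, G.graph.Adj x y → toFun x = toFun y ∨ H.graph.Adj (toFun x) (toFun y)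

instance : Category.{u} Gr.{u} where
  Hom G H := Hom G H
  id G := ⟨id, fun h => Or.inr h⟩
  comp f g := ⟨g.toFun ∘ f.toFun, fun h => by
    rcases f.map_adj h with h | h
    · exact Or.inl (congrArg g.toFun h)
    · exact g.map_adj h⟩

@[ext]
theorem hom_ext {G H : Gr.{u}} {f g : G ⟶ H} (h : ∀ x, f.toFun x = g.toFun x) : f = g :=
  Hom.ext (funext h)

@[simp]
theorem id_toFun (G : Gr.{u}) : Hom.toFun (𝟙 G) = id := rfl

@[simp]
theorem comp_toFun {G H K : Gr.{u}} (f : G ⟶ H) (g : H ⟶ K) :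
    Hom.toFun (f ≫ g) = g.toFun ∘ f.toFun := rfl

/-- The vertex set functor. -/
def vertices : Gr.{u} ⥤ Type u where
  obj G := G.V
  map f := ↾f.toFun

section Colimits

variable {J : Type u} [Category.{0} J] (F : J ⥤ Gr.{u})

/-- The colimit of a diagram of graphs: glue the vertex sets, and take the images of all edges. -/
noncomputable def colimitGraph : Gr.{u} where
  V := colimit (F ⋙ vertices)
  graph :=
    { Adj := fun a b => a ≠ b ∧ ∃ (j : J) (x y : (F.obj j).V), (F.obj j).graph.Adj x y ∧
        colimit.ι (F ⋙ vertices) j x = a ∧ colimit.ι (F ⋙ vertices) j y = b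
      symm := ⟨fun _ _ ⟨hne, j, x, y, h, hx, hy⟩ => ⟨hne.symm, j, y, x, h.symm, hy, hx⟩⟩
      loopless := ⟨fun _ h => h.1 rfl⟩ }

/-- The gluing cocone. -/
noncomputable def colimitCocone : Cocone F where
  pt := colimitGraph F
  ι :=
    { app := fun j => ⟨fun x => colimit.ι (F ⋙ vertices) j x, fun {x y} h => by
        by_cases hxy : colimit.ι (F ⋙ vertices) j x = colimit.ι (F ⋙ vertices) j y
        · exact Or.inl hxy
        · exact Or.inr ⟨hxy, j, x, y, h, rfl, rfl⟩⟩
      naturality := fun i j f => by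
        apply hom_ext
        intro x
        exact ConcreteCategory.congr_hom (colimit.w (F ⋙ vertices) f) x }

/-- The gluing cocone is a colimit cocone. -/
noncomputable def colimitCoconeIsColimit : IsColimit (colimitCocone F) where
  desc s :=
    { toFun := fun a => colimit.desc (F ⋙ vertices) (vertices.mapCocone s) a
      map_adj := by
        rintro a b ⟨-, j, x, y, h, rfl, rfl⟩
        have e : ∀ z : (F.obj j).V, colimit.desc (F ⋙ vertices) (vertices.mapCocone s)
            (colimit.ι (F ⋙ vertices) j z) = (s.ι.app j).toFun z := fun z =>
          ConcreteCategory.congr_hom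
            (colimit.ι_desc (F := F ⋙ vertices) (vertices.mapCocone s) j) z
        rw [e x, e y]
        exact (s.ι.app j).map_adj h }
  fac s j := by
    apply hom_ext
    intro z
    exact ConcreteCategory.congr_hom
      (colimit.ι_desc (F := F ⋙ vertices) (vertices.mapCocone s) j) z
  uniq s m hm := by
    apply hom_ext
    intro a
    let m' : colimit (F ⋙ vertices) ⟶ s.pt.V := ↾fun a => m.toFun a
    have h : m' = colimit.desc (F ⋙ vertices) (vertices.mapCocone s) := by
      apply colimit.hom_ext
      intro j
      refine Eq.trans ?_ (colimit.ι_desc (F := F ⋙ vertices) (vertices.mapCocone s) j).symm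
      ext z
      exact congrFun (congrArg Hom.toFun (hm j)) z
    exact ConcreteCategory.congr_hom h a

instance : HasColimitsOfSize.{0, u} Gr.{u} where
  has_colimits_of_shape _ _ :=
    { has_colimit := fun F => ⟨⟨⟨colimitCocone F, colimitCoconeIsColimit F⟩⟩⟩ }

end Colimits

end Gr

/-! ### Structured decompositions and width -/

/-- The schema `E ⇉ V` of graphs: `zero` is `E`, `one` is `V`, `left` and `right` are the source
and target maps. -/
abbrev GrSch : Type := WalkingParallelPair

/-- A graph (of decomposition shapes) is a functor on the schema. -/
abbrev ShapeGraph : Type (u + 1) := GrSch ⥤ Type u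

namespace ShapeGraph

variable (S : ShapeGraph.{u})

/-- The vertices of a shape. -/
abbrev Vert : Type u := S.obj WalkingParallelPair.one

/-- The edges of a shape. -/
abbrev Edge : Type u := S.obj WalkingParallelPair.zero

/-- The source of an edge. -/
def src (e : S.Edge) : S.Vert := S.map WalkingParallelPairHom.left e

/-- The target of an edge. -/
def tgt (e : S.Edge) : S.Vert := S.map WalkingParallelPairHom.right e

/-- A shape is a forest if its underlying undirected multigraph has no cycles: it has no loops, no
two distinct edges have the same pair of endpoints, and the resulting simple graph is acyclic. -/
structure IsForest : Prop where
  no_loops : ∀ e : S.Edge, S.src e ≠ S.tgt e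
  no_parallel : Function.Injective fun e : S.Edge => s(S.src e, S.tgt e)
  acyclic : (SimpleGraph.fromEdgeSet (Set.range fun e : S.Edge => s(S.src e, S.tgt e))).IsAcyclic

end ShapeGraph

section Width

universe v₁ u₁ v₂ u₂ v₃ u₃

/-- A `K`-valued structured decomposition: a shape graph `S` and a diagram `∫ S ⥤ K`, where `∫ S`
is the category of elements (one object for each vertex and for each edge of `S`, and a span from
each edge to its source and target). -/
structure StructuredDecomposition (K : Type u₁) [Category.{v₁} K] where
  shape : ShapeGraph.{u}
  diagram : shape.Elements ⥤ K

variable {K : Type u₁} [Category.{v₁} K] {C : Type u₂} [Category.{v₂} C]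

/-- Postcomposition of structured decompositions with a functor. -/
def StructuredDecomposition.map (Ω : K ⥤ C) (d : StructuredDecomposition.{u} K) :
    StructuredDecomposition.{u} C where
  shape := d.shape
  diagram := d.diagram ⋙ Ω

/-- The object glued from a structured decomposition by means of `Ω`: apply `Ω` to all bags and
adhesions, then take the colimit. -/
noncomputable def lanConst [HasColimitsOfSize.{0, u} C] (Ω : K ⥤ C)
    (d : StructuredDecomposition.{u} K) : C :=
  colimit (d.map Ω).diagram

/-- A `(𝒢, Ω)`-completion of `x`. -/
structure Completion [HasColimitsOfSize.{0, u} C] (𝒢 : ShapeGraph.{u} → Prop) (Ω : K ⥤ C)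
    (x : C) where
  decomposition : StructuredDecomposition.{u} K
  shape_mem : 𝒢 decomposition.shape
  hom : x ⟶ lanConst Ω decomposition
  mono : Mono hom

/-- A functor `P` absorbs pullbacks if the apex of every pullback square of monomorphisms over an
object `P a` is (up to isomorphism) again in the image of `P`. -/
def PullbackAbsorbing {A : Type u₃} [Category.{v₃} A] (P : A ⥤ C) : Prop :=
  ∀ ⦃a : A⦄ ⦃y z w : C⦄ (p : w ⟶ P.obj a) (q : w ⟶ z) (f : P.obj a ⟶ y) (g : z ⟶ y),
    Mono p → Mono q → Mono f → Mono g → IsPullback p q f g →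
      ∃ a' : A, Nonempty (P.obj a' ≅ w)

/-- `x` has `(𝒢, Ω)`-width bounded by the (full) pullback-absorbing subcategory `B`: it has a
completion all of whose bags and adhesions lie in `B`. -/
def WidthBoundedBy [HasColimitsOfSize.{0, u} C] (𝒢 : ShapeGraph.{u} → Prop) (Ω : K ⥤ C)
    (B : ObjectProperty K) (_hB : PullbackAbsorbing B.ι) (x : C) : Prop :=
  Nonempty (Completion.{u} 𝒢 (B.ι ⋙ Ω) x)

end Width

/-! ### Sequences of sets and of graphs -/

/-- Sequences of finite sets, with only finitely many non-empty terms. -/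
def finiteSupportSet : ObjectProperty (Discrete ℕ ⥤ FintypeCat.{u}) :=
  fun F => {n : ℕ | Nonempty (F.obj ⟨n⟩)}.Finite

/-- The category of finitely supported sequences of finite sets. -/
abbrev FinSetStar : Type (u + 1) := finiteSupportSet.{u}.FullSubcategory

/-- Sequences of graphs, with only finitely many non-empty terms. -/
def finiteSupportGr : ObjectProperty (Discrete ℕ ⥤ Gr.{u}) :=
  fun F => {n : ℕ | Nonempty (F.obj ⟨n⟩).V}.Finite

/-- The category of finitely supported sequences of graphs. -/
abbrev GrStar : Type (u + 1) := finiteSupportGr.{u}.FullSubcategory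

/-- The functor sending a finite set to the complete graph on it. -/
def completeGr : FintypeCat.{u} ⥤ Gr.{u} where
  obj X := ⟨X, ⊤⟩
  map f := ⟨fun x => f x, fun {x y} _ => by
    by_cases h : f x = f y
    · exact Or.inl h
    · exact Or.inr h⟩

/-- The termwise complete graph functor. -/
def completeGrStar : FinSetStar.{u} ⥤ GrStar.{u} :=
  finiteSupportGr.lift
    (finiteSupportSet.ι ⋙ (Functor.whiskeringRight (Discrete ℕ) _ _).obj completeGr)
    (fun X => X.property)

/-- Adjacency in the graph obtained from a sequence of graphs by making each of them complete to
the next one. -/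
inductive StackAdj (F : Discrete ℕ ⥤ Gr.{u}) :
    (Σ n : ℕ, (F.obj ⟨n⟩).V) → (Σ n : ℕ, (F.obj ⟨n⟩).V) → Prop
  | within (n : ℕ) (x y : (F.obj ⟨n⟩).V) (h : (F.obj ⟨n⟩).graph.Adj x y) :
      StackAdj F ⟨n, x⟩ ⟨n, y⟩
  | up (n : ℕ) (x : (F.obj ⟨n⟩).V) (y : (F.obj ⟨n + 1⟩).V) : StackAdj F ⟨n, x⟩ ⟨n + 1, y⟩
  | down (n : ℕ) (x : (F.obj ⟨n + 1⟩).V) (y : (F.obj ⟨n⟩).V) : StackAdj F ⟨n + 1, x⟩ ⟨n, y⟩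

theorem StackAdj.ne {F : Discrete ℕ ⥤ Gr.{u}} {a b : Σ n : ℕ, (F.obj ⟨n⟩).V}
    (h : StackAdj F a b) : a ≠ b := by
  intro hb
  rcases h with ⟨n, x, y, h⟩ | ⟨n, x, y⟩ | ⟨n, x, y⟩
  · simp only [Sigma.mk.injEq, heq_eq_eq, true_and] at hb
    exact SimpleGraph.Adj.ne h hb
  · have := congrArg Sigma.fst hb
    simp at this
  · have := congrArg Sigma.fst hb
    simp at this

/-- The disjoint union of a sequence of graphs, each made complete to the next one. -/
def stackGraph (F : Discrete ℕ ⥤ Gr.{u}) : Gr.{u} where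
  V := Σ n : ℕ, (F.obj ⟨n⟩).V
  graph :=
    { Adj := StackAdj F
      symm := ⟨by
        rintro _ _ (⟨n, x, y, h⟩ | ⟨n, x, y⟩ | ⟨n, x, y⟩)
        · exact .within n y x h.symm
        · exact .down n y x
        · exact .up n y x⟩
      loopless := ⟨fun _ h => h.ne rfl⟩ }

/-- The functor making each graph in a sequence complete to the next one. -/
def stack : GrStar.{u} ⥤ Gr.{u} where
  obj F := stackGraph F.obj
  map {F G} f := ⟨fun p => ⟨p.1, (f.hom.app ⟨p.1⟩).toFun p.2⟩, by
    rintro _ _ (⟨n, x, y, h⟩ | ⟨n, x, y⟩ | ⟨n, x, y⟩)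
    · rcases (f.hom.app ⟨n⟩).map_adj h with h | h
      · exact Or.inl (congrArg (Sigma.mk n) h)
      · exact Or.inr (.within n _ _ h)
    · exact Or.inr (.up n _ _)
    · exact Or.inr (.down n _ _)⟩

/-- Stacks of complete graphs. -/
def completeStack : FinSetStar.{u} ⥤ Gr.{u} := completeGrStar ⋙ stack

/-- The full subcategory of sequences all of whose terms have at most `k` elements. -/
def finSetStarLE (k : ℕ) : ObjectProperty FinSetStar.{u} :=
  fun F => ∀ n : ℕ, Nat.card (F.obj.obj ⟨n⟩) ≤ k

/-- Monomorphisms of finitely supported sequences are termwise injective. -/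
theorem injective_of_mono {X Y : FinSetStar.{u}} (p : X ⟶ Y) (hp : Mono p) (n : ℕ) :
    Function.Injective (p.hom.app ⟨n⟩) := by
  classical
  intro a b hab
  let c : ∀ m : Discrete ℕ, X.obj.obj m ⟶ X.obj.obj m :=
    Function.update (fun m => 𝟙 (X.obj.obj m)) ⟨n⟩ (FintypeCat.homMk (Equiv.swap a b))
  let g : X ⟶ X := ObjectProperty.homMk (Discrete.natTrans c)
  have key : g ≫ p = 𝟙 X ≫ p := by
    ext m x
    have hx : (p.hom.app m) (c m x) = p.hom.app m x := by
      by_cases hm : m = ⟨n⟩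
      · subst hm
        simp only [c, Function.update_self]
        change (p.hom.app ⟨n⟩) (Equiv.swap a b x) = _
        by_cases hxa : x = a
        · subst hxa; rw [Equiv.swap_apply_left]; exact hab.symm
        · by_cases hxb : x = b
          · subst hxb; rw [Equiv.swap_apply_right]; exact hab
          · rw [Equiv.swap_apply_of_ne_of_ne hxa hxb]
      · simp only [c, Function.update_of_ne hm]
        rfl
    simpa [g] using hx
  have hg : g = 𝟙 X := (cancel_mono p).1 key
  have h1 : c ⟨n⟩ = 𝟙 _ := congrArg (fun t : X ⟶ X => t.hom.app ⟨n⟩) hg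
  have h2 : Equiv.swap a b a = a := by
    have := ConcreteCategory.congr_hom h1 a
    simp only [c, Function.update_self] at this
    exact this
  rw [Equiv.swap_apply_left] at h2
  exact h2.symm

/-- Sequences of sets with at most `k` elements form a pullback-absorbing subcategory. -/
theorem finSetStarLE_pullbackAbsorbing (k : ℕ) :
    PullbackAbsorbing (finSetStarLE.{u} k).ι := by
  intro a y z w p q f g hp _ _ _ _
  exact ⟨⟨w, fun n => (Nat.card_le_card_of_injective _ (injective_of_mono p hp n)).trans
    (a.property n)⟩, ⟨Iso.refl _⟩⟩

/-! ### Layered tree-width -/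

section LayeredTreewidth

variable {V : Type u} (G : SimpleGraph V)

/-- A tree decomposition of a graph. -/
structure TreeDecomposition where
  node : Type u
  tree : SimpleGraph node
  isTree : tree.IsTree
  bag : node → G.Subgraph
  edge_mem : ∀ x y : V, G.Adj x y → ∃ t, {x, y} ⊆ (bag t).verts
  connected : ∀ x : V, (tree.induce {t | x ∈ (bag t).verts}).Connected

/-- A layering of a graph: a finite sequence of vertex subsets that partitions the vertex set, such
that the ends of every edge lie in the same or in consecutive subsets. -/
structure Layering where
  length : ℕ
  layer : Fin length → Set V
  disjoint : ∀ i j, i ≠ j → Disjoint (layer i) (layer j)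
  cover : ⋃ i, layer i = Set.univ
  adj : ∀ i j, ∀ x ∈ layer i, ∀ y ∈ layer j, G.Adj x y → |(i : ℤ) - (j : ℤ)| ≤ 1

/-- A layered tree decomposition. -/
structure LayeredTreeDecomposition where
  layering : Layering G
  treeDecomposition : TreeDecomposition G

/-- The width of a layered tree decomposition: the largest number of vertices shared by a bag and
a layer. -/
noncomputable def LayeredTreeDecomposition.width (D : LayeredTreeDecomposition G) : ℕ∞ :=
  ⨆ (i : Fin D.layering.length) (t : D.treeDecomposition.node),
    ((D.treeDecomposition.bag t).verts ∩ D.layering.layer i).encard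

/-- The layered tree-width of a graph: the least width of a layered tree decomposition. -/
noncomputable def layeredTreewidth : ℕ∞ :=
  ⨅ D : LayeredTreeDecomposition G, D.width

end LayeredTreewidth

end LayeredWidth

open LayeredWidth

namespace LayeredWidth

/-! Colimits of graphs are computed on vertex sets, with edges the images of edges of the diagram.
So each edge of a glued graph lies in the image of one vertex bag. Two representatives of a glued
vertex are linked by a zigzag of span maps, each staying at a node or moving along one edge of the
shape; hence the nodes whose bag contains a given vertex are connected (`gluedBag_connected`). Maps
of sequences preserve the index, so "level" is a cocone to the path on ℕ and descends to the
colimit. Each image of a vertex bag meets each level in at most `k` vertices. Pulling bags and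
levels back along the monomorphism, and completing the forest to a tree, gives the layered tree
decomposition.

Conversely, cut each bag into its layers and use intersections of bags as adhesions. Send a vertex
to its class in any bag containing it: connectedness makes this independent of the bag, and then an
edge inside a bag, whose ends have levels differing by at most one, is preserved by the stack of
complete graphs. The inclusions of the bags in the vertex set of `G` form a cocone, which gives a
left inverse. -/

/-- A monomorphism of graphs is injective on vertices. -/
theorem Gr.injective_of_mono {G H : Gr.{u}} (f : G ⟶ H) [Mono f] :
    Function.Injective f.toFun := by
  intro a b hab
  let pt (x : G.V) : (⟨PUnit, ⊥⟩ : Gr.{u}) ⟶ G := ⟨fun _ => x, fun h => h.elim⟩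
  have h : pt a = pt b := by
    rw [← cancel_mono f]
    exact Gr.hom_ext fun _ => hab
  exact congrFun (congrArg Gr.Hom.toFun h) PUnit.unit

/-- A homomorphism of graphs that is injective on vertices is a monomorphism. -/
theorem Gr.mono_of_injective {G H : Gr.{u}} (f : G ⟶ H) (hf : Function.Injective f.toFun) :
    Mono f :=
  ⟨fun _ _ h => Gr.hom_ext fun x => hf (congrFun (congrArg Gr.Hom.toFun h) x)⟩

/-! ### Arrows in the category of elements of a shape -/

namespace ShapeGraph

variable (S : ShapeGraph.{u})

/-- The simple graph underlying a shape. -/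
def toSimple : SimpleGraph S.Vert :=
  SimpleGraph.fromEdgeSet (Set.range fun e : S.Edge => s(S.src e, S.tgt e))

variable {S}

/-- The object of the category of elements given by a vertex. -/
def vert (v : S.Vert) : S.Elements := ⟨WalkingParallelPair.one, v⟩

/-- The vertex itself, or the source of the edge, given by an object of the category of
elements. -/
def host : S.Elements → S.Vert
  | ⟨WalkingParallelPair.one, v⟩ => v
  | ⟨WalkingParallelPair.zero, e⟩ => S.src e

/-- Every object of the category of elements maps to its host. -/
def toHost : (j : S.Elements) → (j ⟶ vert (host j))
  | ⟨WalkingParallelPair.one, _⟩ => 𝟙 _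
  | ⟨WalkingParallelPair.zero, _⟩ => ⟨WalkingParallelPairHom.left, rfl⟩

end ShapeGraph

/-! ### Bags of a glued graph and their connectedness -/

section Glue

open ShapeGraph

variable {S : ShapeGraph.{u}} (D : S.Elements ⥤ Gr.{u})

/-- The vertices of the glued graph that come from a given vertex of the shape. -/
def gluedBag (v : S.Vert) : Set (Gr.colimitGraph D).V :=
  Set.range (colimit.ι (D ⋙ Gr.vertices) (vert v))

variable {D}

theorem ι_map_apply {i j : S.Elements} (f : i ⟶ j) (x : (D.obj i).V) :
    colimit.ι (D ⋙ Gr.vertices) j ((D.map f).toFun x) = colimit.ι (D ⋙ Gr.vertices) i x :=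
  ConcreteCategory.congr_hom (colimit.w (D ⋙ Gr.vertices) f) x

theorem ι_mem_gluedBag {j : S.Elements} {v : S.Vert} (f : j ⟶ vert v) (x : (D.obj j).V) :
    (colimit.ι (D ⋙ Gr.vertices) j x : (Gr.colimitGraph D).V) ∈ gluedBag D v :=
  ⟨(D.map f).toFun x, ι_map_apply f x⟩

theorem exists_gluedBag_of_adj {a b : (Gr.colimitGraph D).V}
    (h : (Gr.colimitGraph D).graph.Adj a b) : ∃ v, a ∈ gluedBag D v ∧ b ∈ gluedBag D v := by
  obtain ⟨-, j, x, y, -, rfl, rfl⟩ := h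
  exact ⟨host j, ι_mem_gluedBag (toHost j) x, ι_mem_gluedBag (toHost j) y⟩

theorem exists_mem_gluedBag (a : (Gr.colimitGraph D).V) : ∃ v, a ∈ gluedBag D v := by
  obtain ⟨j, x, rfl⟩ := Types.jointly_surjective' (F := D ⋙ Gr.vertices) a
  exact ⟨host j, ι_mem_gluedBag (toHost j) x⟩

/-- The host changes only along the arrow from an edge to its target, and there the old and new
hosts are the two ends of that edge. -/
theorem reachable_host {i j : S.Elements} (f : i ⟶ j) {A : Set S.Vert}
    (hA : ∀ v, Nonempty (i ⟶ vert v) → v ∈ A) (hi : host i ∈ A) (hj : host j ∈ A) :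
    (S.toSimple.induce A).Reachable ⟨host i, hi⟩ ⟨host j, hj⟩ := by
  rcases i with ⟨_ | _, i⟩ <;> rcases j with ⟨_ | _, j⟩ <;> rcases f with ⟨f, hf⟩ <;>
    change WalkingParallelPairHom _ _ at f
  · cases f
    change S.map (𝟙 _) i = j at hf
    simp only [S.map_id] at hf
    subst hf
    rfl
  · have key : ∀ (h : S.src i ∈ A) (h' : S.tgt i ∈ A),
        (S.toSimple.induce A).Reachable ⟨S.src i, h⟩ ⟨S.tgt i, h'⟩ := by
      intro h h'
      by_cases hne : S.src i = S.tgt i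
      · have : (⟨S.src i, h⟩ : A) = ⟨S.tgt i, h'⟩ := Subtype.ext hne
        rw [this]
      · refine SimpleGraph.Adj.reachable ?_
        simp only [SimpleGraph.comap_adj, toSimple, SimpleGraph.fromEdgeSet_adj]
        exact ⟨⟨i, rfl⟩, hne⟩
    cases f
    · change S.src i = j at hf
      subst hf
      rfl
    · change S.tgt i = j at hf
      subst hf
      exact key _ _
  · cases f
  · cases f
    change S.map (𝟙 _) i = j at hf
    simp only [S.map_id] at hf
    subst hf
    rfl

/-- Induction along the zigzag identifying `p` with `q`: every intermediate representative still
maps to `a`, so its host stays among the nodes whose bag contains `a`. -/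
theorem reachable_of_ι_eq (a : (Gr.colimitGraph D).V) (p q : Σ j, (D ⋙ Gr.vertices).obj j)
    (h : Relation.EqvGen (D ⋙ Gr.vertices).ColimitTypeRel p q)
    (hp : host p.1 ∈ {v | a ∈ gluedBag D v}) (hq : host q.1 ∈ {v | a ∈ gluedBag D v})
    (hpa : colimit.ι (D ⋙ Gr.vertices) p.1 p.2 = a) :
    (S.toSimple.induce {v | a ∈ gluedBag D v}).Reachable ⟨host p.1, hp⟩ ⟨host q.1, hq⟩ := by
  have eq_of_rel : ∀ p q : Σ j, (D ⋙ Gr.vertices).obj j,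
      Relation.EqvGen (D ⋙ Gr.vertices).ColimitTypeRel p q →
      colimit.ι (D ⋙ Gr.vertices) p.1 p.2 = colimit.ι (D ⋙ Gr.vertices) q.1 q.2 := by
    intro p q h
    induction h with
    | rel p q h =>
      obtain ⟨f, hf⟩ := h
      rw [hf]
      exact (ι_map_apply f p.2).symm
    | refl => rfl
    | symm _ _ _ ih => exact ih.symm
    | trans _ _ _ _ _ ih ih' => exact ih.trans ih'
  induction h with
  | rel p q h =>
    obtain ⟨f, -⟩ := h
    refine reachable_host f (fun v ⟨g⟩ => ?_) hp hq
    subst hpa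
    exact ι_mem_gluedBag g p.2
  | refl => rfl
  | symm p q h ih => exact (ih hq hp ((eq_of_rel _ _ h).trans hpa)).symm
  | trans p r q h h' ih ih' =>
    have hra := (eq_of_rel _ _ h).symm.trans hpa
    have hr : host r.1 ∈ {v | a ∈ gluedBag D v} := by
      subst hra
      exact ι_mem_gluedBag (toHost r.1) r.2
    exact (ih hp hr hpa).trans (ih' hr hq hra)

theorem gluedBag_connected (a : (Gr.colimitGraph D).V) :
    (S.toSimple.induce {v | a ∈ gluedBag D v}).Connected := by
  rw [SimpleGraph.connected_iff]
  refine ⟨?_, (exists_mem_gluedBag a).elim fun v hv => ⟨⟨v, hv⟩⟩⟩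
  rintro ⟨v, x, hx⟩ ⟨w, y, hy⟩
  exact reachable_of_ι_eq a ⟨vert v, x⟩ ⟨vert w, y⟩ (Types.colimit_eq (hx.trans hy.symm)) _ _ hx

end Glue

/-! ### Levels and layerings -/

/-- The graph on the natural numbers whose edges join consecutive numbers. -/
def ladder : Gr.{u} where
  V := ULift.{u} ℕ
  graph :=
    { Adj := fun a b => a.down + 1 = b.down ∨ b.down + 1 = a.down
      symm := ⟨fun _ _ h => h.symm⟩
      loopless := ⟨fun _ h => by omega⟩ }

/-- The homomorphism that records the level of each vertex of a stack. -/
def stackLevel (F : Discrete ℕ ⥤ Gr.{u}) : stackGraph F ⟶ ladder where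
  toFun p := ⟨p.1⟩
  map_adj := by
    rintro _ _ (⟨n, x, y, h⟩ | ⟨n, x, y⟩ | ⟨n, x, y⟩)
    · exact Or.inl rfl
    · exact Or.inr (Or.inl rfl)
    · exact Or.inr (Or.inr rfl)

/-- The level homomorphisms form a cocone over any diagram of stacks of complete graphs. -/
def levelCocone {J : Type u} [Category.{0} J] (d : J ⥤ FinSetStar.{u}) :
    Cocone (d ⋙ completeStack) where
  pt := ladder
  ι :=
    { app := fun j => stackLevel (completeGrStar.obj (d.obj j)).obj
      -- Morphisms of sequences act termwise, so they do not change the level.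
      naturality := fun _ _ _ => rfl }

theorem ladder_hom_adj {G : Gr.{u}} (f : G ⟶ ladder) {x y : G.V} (h : G.graph.Adj x y) :
    |((f.toFun x).down : ℤ) - (f.toFun y).down| ≤ 1 := by
  rcases f.map_adj h with h | h | h
  · simp [h]
  · rw [abs_le]; omega
  · rw [abs_le]; omega

/-- The layering of a finite graph by a homomorphism to the ladder. -/
theorem exists_layering_of_ladder_hom {G : Gr.{u}} [Finite G.V] (f : G ⟶ ladder) :
    ∃ L : Layering G.graph, ∀ i, L.layer i = {x | (f.toFun x).down = (i : ℕ)} := by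
  -- `N` bounds all levels, so the `N + 1` layers `0, …, N` suffice; some may be empty.
  obtain ⟨N, hN⟩ := (Set.finite_range fun x => (f.toFun x).down).bddAbove
  refine ⟨⟨N + 1, fun i => {x | (f.toFun x).down = (i : ℕ)}, ?_, ?_, ?_⟩, fun _ => rfl⟩
  · intro i j hij
    refine Set.disjoint_left.2 fun x hx hy => hij (Fin.ext ?_)
    exact Eq.trans (Eq.symm hx) hy
  · refine Set.eq_univ_of_forall fun x => Set.mem_iUnion.2 ⟨⟨(f.toFun x).down, ?_⟩, rfl⟩
    exact Nat.lt_succ_of_le (hN ⟨x, rfl⟩)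
  · intro i j x hx y hy h
    rw [← show (f.toFun x).down = (i : ℕ) from hx, ← show (f.toFun y).down = (j : ℕ) from hy]
    exact ladder_hom_adj f h

/-! ### From width to layered tree-width -/

/-- A decomposition of a graph over a forest gives a tree decomposition with bags contained in the
given ones. -/
theorem exists_treeDecomposition_of_isAcyclic {V : Type u} (G : SimpleGraph V) {N : Type u}
    {T : SimpleGraph N} (hT : T.IsAcyclic) (B : N → Set V)
    (hadj : ∀ x y, G.Adj x y → ∃ t, x ∈ B t ∧ y ∈ B t)
    (hconn : ∀ x, (T.induce {t | x ∈ B t}).Connected) :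
    ∃ D : TreeDecomposition G, ∀ t, (D.bag t).verts = ∅ ∨ ∃ s, (D.bag t).verts = B s := by
  cases isEmpty_or_nonempty N with
  | inl hN =>
    -- A tree has a node even if the forest has none; then `V` is empty, and a single node with
    -- empty bag serves.
    have hV : IsEmpty V := ⟨fun x => (hconn x).nonempty.elim fun t => hN.elim t.1⟩
    exact ⟨⟨PUnit, ⊥, .of_subsingleton, fun _ => ⊥, fun x => hV.elim x, fun x => hV.elim x⟩,
      fun _ => Or.inl rfl⟩
  | inr hN =>
    -- Extend the forest to a spanning tree of the complete graph on `N`; added edges preserve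
    -- connectedness of the induced subgraphs.
    obtain ⟨T', hle, -, hT'⟩ :=
      (SimpleGraph.connected_top (V := N)).exists_isTree_le_of_le_of_isAcyclic le_top hT
    refine ⟨⟨N, T', hT', fun t => (⊤ : G.Subgraph).induce (B t), ?_, ?_⟩,
      fun t => Or.inr ⟨t, rfl⟩⟩
    · intro x y h
      obtain ⟨t, hx, hy⟩ := hadj x y h
      exact ⟨t, Set.pair_subset hx hy⟩
    · exact fun x => (hconn x).mono fun _ _ h => hle h

/-- A graph whose width is bounded by sequences of sets of size at most `k` has layered tree-width
at most `k`. -/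
theorem layeredTreewidth_le_of_widthBoundedBy (k : ℕ) (G : Gr.{u}) [Finite G.V]
    (h : WidthBoundedBy ShapeGraph.IsForest completeStack.{u} (finSetStarLE.{u} k)
      (finSetStarLE_pullbackAbsorbing k) G) :
    layeredTreewidth G.graph ≤ (k : ℕ∞) := by
  obtain ⟨⟨⟨S, d⟩, hS, f, hf⟩⟩ := h
  let D : S.Elements ⥤ Gr.{u} := d ⋙ (finSetStarLE.{u} k).ι ⋙ completeStack
  change G ⟶ colimit D at f
  let e : colimit D ≅ Gr.colimitGraph D :=
    (colimit.isColimit D).coconePointUniqueUpToIso (Gr.colimitCoconeIsColimit D)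
  let g : G ⟶ Gr.colimitGraph D := f ≫ e.hom
  have hg : Function.Injective g.toFun :=
    have : Mono f := hf
    have : Mono g := mono_comp f e.hom
    Gr.injective_of_mono g
  let c : Cocone D := levelCocone (d ⋙ (finSetStarLE.{u} k).ι)
  let l : Gr.colimitGraph D ⟶ ladder := (Gr.colimitCoconeIsColimit D).desc c
  have hl : ∀ j (p : (D.obj j).V), (l.toFun (colimit.ι (D ⋙ Gr.vertices) j p)).down = p.1 :=
    fun j p => congrArg ULift.down <|
      congrFun (congrArg Gr.Hom.toFun ((Gr.colimitCoconeIsColimit D).fac c j)) p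
  obtain ⟨L, hL⟩ := exists_layering_of_ladder_hom (g ≫ l)
  obtain ⟨T, hT⟩ := exists_treeDecomposition_of_isAcyclic G.graph (T := S.toSimple) hS.acyclic
    (fun v => {x | g.toFun x ∈ gluedBag D v})
    (fun x y hxy => by
      rcases g.map_adj hxy with h | h
      · obtain ⟨v, hv⟩ := exists_mem_gluedBag (g.toFun x)
        exact ⟨v, hv, show g.toFun y ∈ gluedBag D v from h ▸ hv⟩
      · exact exists_gluedBag_of_adj h)
    (fun x => gluedBag_connected (g.toFun x))
  refine iInf_le_of_le ⟨L, T⟩ (iSup₂_le fun i t => ?_)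
  change ((T.bag t).verts ∩ L.layer i).encard ≤ _
  rcases hT t with ht | ⟨v, ht⟩
  · simp [ht]
  -- By injectivity the count can be made in the glued graph, where the image lies in that of the
  -- `i`-th term `A` of the bag at `v`.
  · rw [ht, hL, ← hg.injOn.encard_image]
    let A := (d.obj (ShapeGraph.vert v)).obj.obj.obj ⟨(i : ℕ)⟩
    have hA : Nat.card A ≤ k := (d.obj (ShapeGraph.vert v)).property i
    let r : A → (Gr.colimitGraph D).V := fun a =>
      colimit.ι (D ⋙ Gr.vertices) (ShapeGraph.vert v)
        (show (D.obj (ShapeGraph.vert v)).V from Sigma.mk (i : ℕ) a)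
    calc _ ≤ (r '' Set.univ).encard := by
          refine Set.encard_le_encard ?_
          rintro _ ⟨x, ⟨⟨p, hp⟩, hx⟩, rfl⟩
          have hx' : (l.toFun (g.toFun x)).down = (i : ℕ) := hx
          rw [← hp] at hx'
          obtain ⟨n, p⟩ := p
          have hn : n = (i : ℕ) := (hl (ShapeGraph.vert v) ⟨n, p⟩).symm.trans hx'
          subst hn
          exact ⟨p, trivial, hp⟩
      _ ≤ Set.encard (Set.univ : Set A) := Set.encard_image_le _ _
      _ ≤ k := by
          rw [Set.encard_univ, ENat.card_eq_coe_natCard]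
          exact_mod_cast hA

/-! ### A structured decomposition from layered bags -/

section Realize

variable {V N : Type u}

/-- The sequence of the level sets of a function, restricted to a set. -/
noncomputable def levelSets [Finite V] (ℓ : V → ℕ) : Set V ⥤ FinSetStar.{u} where
  obj A :=
    ⟨Discrete.functor fun n => FintypeCat.of {x : V // x ∈ A ∧ ℓ x = n},
      (Set.finite_range ℓ).subset fun _ ⟨x⟩ => ⟨x.1, x.2.2⟩⟩
  map {A B} h := ObjectProperty.homMk <| Discrete.natTrans fun _ =>
    FintypeCat.homMk fun x => ⟨x.1, leOfHom h x.2.1, x.2.2⟩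

/-- A simple graph as a shape, with its edges oriented arbitrarily. -/
noncomputable def ShapeGraph.ofSimple (T : SimpleGraph N) : ShapeGraph.{u} :=
  parallelPair (X := (T.edgeSet : Type u)) (Y := N)
    (↾fun e => (Quot.out e.1).1) (↾fun e => (Quot.out e.1).2)

variable {T : SimpleGraph N}

theorem ShapeGraph.mk_src_tgt_ofSimple (e : T.edgeSet) :
    s((ofSimple T).src e, (ofSimple T).tgt e) = e.1 :=
  Quot.out_eq e.1

theorem ShapeGraph.isForest_ofSimple (hT : T.IsAcyclic) : (ofSimple T).IsForest where
  no_loops (e : T.edgeSet) := by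
    have h : s((ofSimple T).src e, (ofSimple T).tgt e) ∈ T.edgeSet := by
      rw [mk_src_tgt_ofSimple]; exact e.2
    exact SimpleGraph.Adj.ne h
  no_parallel := fun (e e' : T.edgeSet) h => Subtype.ext <| by
    rw [← mk_src_tgt_ofSimple e, ← mk_src_tgt_ofSimple e']
    exact h
  acyclic := by
    have h : (Set.range fun e : (ofSimple T).Edge => s((ofSimple T).src e, (ofSimple T).tgt e)) =
        T.edgeSet :=
      (congrArg Set.range (funext (mk_src_tgt_ofSimple (T := T)))).trans Subtype.range_coe
    rw [h]
    exact (SimpleGraph.fromEdgeSet_edgeSet T).symm ▸ hT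

/-- The bags on the vertices of a shape, extended to the edges by intersection. -/
def bagAt {S : ShapeGraph.{u}} (B : S.Vert → Set V) : S.Elements → Set V
  | ⟨WalkingParallelPair.one, v⟩ => B v
  | ⟨WalkingParallelPair.zero, e⟩ => B (S.src e) ∩ B (S.tgt e)

theorem bagAt_mono {S : ShapeGraph.{u}} (B : S.Vert → Set V) {i j : S.Elements} (f : i ⟶ j) :
    bagAt B i ⊆ bagAt B j := by
  rcases i with ⟨_ | _, i⟩ <;> rcases j with ⟨_ | _, j⟩ <;> rcases f with ⟨f, hf⟩ <;>
    change WalkingParallelPairHom _ _ at f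
  · cases f
    change S.map (𝟙 _) i = j at hf
    simp only [S.map_id] at hf
    subst hf
    rfl
  · cases f
    · change S.src i = j at hf
      subst hf
      exact Set.inter_subset_left
    · change S.tgt i = j at hf
      subst hf
      exact Set.inter_subset_right
  · cases f
  · cases f
    change S.map (𝟙 _) i = j at hf
    simp only [S.map_id] at hf
    subst hf
    rfl

/-- The diagram of the bags of a decomposition. -/
def bagFunctor {S : ShapeGraph.{u}} (B : S.Vert → Set V) : S.Elements ⥤ Set V where
  obj := bagAt B
  map f := homOfLE (bagAt_mono B f)

/-- An adhesion is contained in the bag of its host, so bounding the vertex bags suffices. -/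
theorem finSetStarLE_levelSets [Finite V] {k : ℕ} {S : ShapeGraph.{u}} {B : S.Vert → Set V} {ℓ : V → ℕ}
    (hB : ∀ v n, {x | x ∈ B v ∧ ℓ x = n}.encard ≤ k) (j : S.Elements) :
    finSetStarLE.{u} k ((levelSets ℓ).obj ((bagFunctor B).obj j)) := by
  intro n
  have h : ({x | x ∈ bagAt B j ∧ ℓ x = n} : Set V).encard ≤ k :=
    have hsub : {x | x ∈ bagAt B j ∧ ℓ x = n} ⊆ {x | x ∈ B (ShapeGraph.host j) ∧ ℓ x = n} :=
      fun x hx => ⟨bagAt_mono B (ShapeGraph.toHost j) hx.1, hx.2⟩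
    (Set.encard_le_encard hsub).trans (hB (ShapeGraph.host j) n)
  rw [Set.encard, ENat.card_eq_coe_natCard] at h
  exact_mod_cast h

/-- The vertices of the level sets form a cocone. -/
def underlyingCocone [Finite V] {J : Type u} [Category.{0} J] (W : J ⥤ Set V) (ℓ : V → ℕ) :
    Cocone ((W ⋙ levelSets ℓ) ⋙ completeStack) where
  -- Into a complete graph every map of vertices is a homomorphism; this target is only used to
  -- separate vertices.
  pt := ⟨V, ⊤⟩
  ι :=
    { app := fun _ =>
        { toFun := fun p => p.2.1
          map_adj := fun {p q} _ => em (p.2.1 = q.2.1) }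
      naturality := fun _ _ _ => rfl }

/-- A bounded tree decomposition with a layering bounds the width. -/
theorem widthBoundedBy_of_bags (k : ℕ) (G : Gr.{u}) [Finite G.V] (hT : T.IsAcyclic)
    (B : N → Set G.V) (hadj : ∀ x y, G.graph.Adj x y → ∃ t, x ∈ B t ∧ y ∈ B t)
    (hconn : ∀ x, (T.induce {t | x ∈ B t}).Connected) (ℓ : G.V → ℕ)
    (hℓ : ∀ x y, G.graph.Adj x y → |(ℓ x : ℤ) - ℓ y| ≤ 1)
    (hk : ∀ t n, {x | x ∈ B t ∧ ℓ x = n}.encard ≤ k) :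
    WidthBoundedBy ShapeGraph.IsForest completeStack.{u} (finSetStarLE.{u} k)
      (finSetStarLE_pullbackAbsorbing k) G := by
  let S : ShapeGraph.{u} := ShapeGraph.ofSimple T
  let W : S.Elements ⥤ Set G.V := bagFunctor (S := S) B
  let d : S.Elements ⥤ (finSetStarLE.{u} k).FullSubcategory :=
    (finSetStarLE.{u} k).lift (W ⋙ levelSets ℓ) (finSetStarLE_levelSets (S := S) hk)
  let D : S.Elements ⥤ Gr.{u} := d ⋙ (finSetStarLE.{u} k).ι ⋙ completeStack
  let inc (j : S.Elements) (x : G.V) (hx : x ∈ W.obj j) : (D.obj j).V :=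
    Sigma.mk (ℓ x) ⟨x, hx, rfl⟩
  let φ (j : S.Elements) (x : G.V) (hx : x ∈ W.obj j) : (colimit D).V :=
    (colimit.ι D j).toFun (inc j x hx)
  have φ_map : ∀ {i j : S.Elements} (f : i ⟶ j) (x) (hi : x ∈ W.obj i),
      φ j x (leOfHom (W.map f) hi) = φ i x hi := fun {i j} f x hi =>
    congrFun (congrArg Gr.Hom.toFun (colimit.w D f)) (inc i x hi)
  have φ_eq : ∀ (x : G.V) (s t : {t | x ∈ B t}),
      φ (ShapeGraph.vert (S := S) s.1) x s.2 = φ (ShapeGraph.vert (S := S) t.1) x t.2 := by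
    intro x s t
    obtain ⟨w⟩ := (hconn x).preconnected s t
    induction w with
    | nil => rfl
    | @cons a b _ h _ ih =>
      refine Eq.trans ?_ ih
      have hab : T.Adj a.1 b.1 := h
      let e : T.edgeSet := ⟨s(a.1, b.1), hab⟩
      have he : s(S.src e, S.tgt e) = s(a.1, b.1) := ShapeGraph.mk_src_tgt_ofSimple e
      let je : S.Elements := ⟨WalkingParallelPair.zero, e⟩
      let l : je ⟶ ShapeGraph.vert (S.src e) := ⟨WalkingParallelPairHom.left, rfl⟩
      let r : je ⟶ ShapeGraph.vert (S.tgt e) := ⟨WalkingParallelPairHom.right, rfl⟩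
      -- A vertex in both end bags lies in the adhesion, whose two legs identify its copies.
      have key : ∀ hs ht, φ (ShapeGraph.vert (S.src e)) x hs =
          φ (ShapeGraph.vert (S.tgt e)) x ht := fun hs ht =>
        (φ_map l x ⟨hs, ht⟩).trans (φ_map r x ⟨hs, ht⟩).symm
      -- The chosen orientation of `e` may be opposite to the direction of the walk.
      have main : ∀ p q : N, s(p, q) = s(a.1, b.1) →
          (∀ hs ht, φ (ShapeGraph.vert (S := S) p) x hs =
            φ (ShapeGraph.vert (S := S) q) x ht) →
          φ (ShapeGraph.vert (S := S) a.1) x a.2 = φ (ShapeGraph.vert (S := S) b.1) x b.2 := by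
        intro p q hpq hφ
        rcases Sym2.eq_iff.1 hpq with ⟨rfl, rfl⟩ | ⟨rfl, rfl⟩
        · exact hφ a.2 b.2
        · exact (hφ b.2 a.2).symm
      exact main _ _ he key
  choose t ht using fun x => (hconn x).nonempty.elim fun (t : {t | x ∈ B t}) =>
    (⟨t.1, t.2⟩ : ∃ t, x ∈ B t)
  let f : G ⟶ colimit D :=
    { toFun := fun x => φ (ShapeGraph.vert (S := S) (t x)) x (ht x)
      map_adj := fun {x y} h => by
        obtain ⟨s, hx, hy⟩ := hadj x y h
        rw [φ_eq x ⟨t x, ht x⟩ ⟨s, hx⟩, φ_eq y ⟨t y, ht y⟩ ⟨s, hy⟩]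
        refine (colimit.ι D (ShapeGraph.vert (S := S) s)).map_adj ?_
        -- The levels are generalized to variables so that the relation between them can be
        -- substituted into the dependent pairs.
        have inc_adj : ∀ (m n : ℕ) (hm : ℓ x = m) (hn : ℓ y = n),
            (m = n ∨ m + 1 = n ∨ n + 1 = m) →
            (D.obj (ShapeGraph.vert (S := S) s)).graph.Adj (Sigma.mk m ⟨x, hx, hm⟩)
              (Sigma.mk n ⟨y, hy, hn⟩) := by
          rintro m n hm hn (rfl | rfl | rfl)
          · exact .within m _ _ fun h' => h.ne (congrArg Subtype.val h')
          · exact .up m _ _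
          · exact .down n _ _
        refine inc_adj _ _ rfl rfl ?_
        have := abs_le.1 (hℓ x y h)
        omega }
  have hf : Function.Injective f.toFun := by
    let c : Cocone D := underlyingCocone W ℓ
    refine Function.LeftInverse.injective (g := (colimit.desc D c).toFun) fun x => ?_
    exact congrFun (congrArg Gr.Hom.toFun (colimit.ι_desc c _)) 
      (inc (ShapeGraph.vert (S := S) (t x)) x (ht x))
  exact ⟨⟨⟨S, d⟩, ShapeGraph.isForest_ofSimple hT, f, Gr.mono_of_injective f hf⟩⟩

end Realize

/-! ### From layered tree-width to width -/

/-- A finite graph of layered tree-width at most `k` has width bounded by sequences of sets of size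
at most `k`. -/
theorem widthBoundedBy_of_layeredTreewidth_le (k : ℕ) (G : Gr.{u}) [Finite G.V]
    (h : layeredTreewidth G.graph ≤ (k : ℕ∞)) :
    WidthBoundedBy ShapeGraph.IsForest completeStack.{u} (finSetStarLE.{u} k)
      (finSetStarLE_pullbackAbsorbing k) G := by
  obtain ⟨⟨L, T⟩, hD⟩ : ∃ D : LayeredTreeDecomposition G.graph, D.width ≤ k := by
    by_contra! hD
    -- The infimum is attained to within `k`: if every width exceeded `k`, all would be at least `k
    -- + 1`, and so would their infimum.
    have : ((k + 1 : ℕ) : ℕ∞) ≤ layeredTreewidth G.graph := le_iInf fun D => by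
      push_cast
      exact Order.add_one_le_of_lt (hD D)
    have := this.trans h
    norm_cast at this
    omega
  have cover : ∀ x, ∃ i, x ∈ L.layer i := fun x =>
    Set.mem_iUnion.1 (L.cover ▸ Set.mem_univ x)
  choose ℓ hℓ using cover
  refine widthBoundedBy_of_bags k G T.isTree.isAcyclic (fun t => (T.bag t).verts) ?_
    T.connected (fun x => (ℓ x : ℕ)) (fun x y hxy => L.adj _ _ x (hℓ x) y (hℓ y) hxy) ?_
  · intro x y hxy
    obtain ⟨t, ht⟩ := T.edge_mem x y hxy
    exact ⟨t, ht (Set.mem_insert _ _), ht (Set.mem_insert_of_mem _ rfl)⟩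
  · intro t n
    by_cases hn : n < L.length
    · refine le_trans (Set.encard_le_encard ?_) ((le_iSup₂ (f := fun i t =>
        ((T.bag t).verts ∩ L.layer i).encard) ⟨n, hn⟩ t).trans hD)
      rintro x ⟨hx, rfl⟩
      exact ⟨hx, hℓ x⟩
    -- Levels beyond the last layer contain no vertices.
    · have : {x | x ∈ (T.bag t).verts ∧ (ℓ x : ℕ) = n} = ∅ :=
        Set.eq_empty_of_forall_notMem fun x hx => hn (hx.2 ▸ (ℓ x).isLt)
      rw [this]
      simp

end LayeredWidth

theorem mainTheorem4 (k : ℕ) (G : Gr.{u}) (hG : Finite G.V) :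
    WidthBoundedBy ShapeGraph.IsForest completeStack.{u} (finSetStarLE.{u} k)
        (finSetStarLE_pullbackAbsorbing k) G ↔
      layeredTreewidth G.graph ≤ (k : ℕ∞) :=
  ⟨layeredTreewidth_le_of_widthBoundedBy k G, widthBoundedBy_of_layeredTreewidth_le k G⟩
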